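/- Let $n,N\ge 1$ and let $\Omega\subset\mathbb R^n$ be nonempty, open and bounded. For $u\in L^1(\mathbb R^n)$ let $|Du|(\mathbb R^n)=\sup\{\int_{\mathbb R^n} u\,\mathrm{div}\,\varphi\,dx : \varphi\in C_c^\infty(\mathbb R^n;\mathbb R^n),\ |\varphi|\le 1\}\in[0,\infty]$ be its total variation, and let $\mathrm{Per}(E)=|D\mathbf 1_E|(\mathbb R^n)$. Let $BV_0(\Omega)$ be the set of $u\in L^1(\mathbb R^n)$ with $|Du|(\mathbb R^n)<\infty$ and $u=0$ a.e. on $\mathbb R^n\setminus\Omega$ (if $\partial\Omega$ is Lipschitz, this is $BV(\Omega)$ with functions extended by $0$). Let $\Sigma=\bigcup_{i=1}^N\{te_i : t\ge 0\}\subset\mathbb R^N$. Call $u=(u^1,\dots,u^N)$ admissible if $u^i\in BV_0(\Omega)$ and $\|u^i\|_{1}=1$ for every $i$, and $u(x)\in\Sigma$ for a.e. $x\in\Omega$. Let $\mathcal E(u)=\sum_{i=1}^N|Du^i|(\mathbb R^n)$, let $\Lambda_N=\inf\{\mathcal E(u): u\text{ admissible}\}$, and call an admissible $u$ with $\mathcal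 E(u)=\Lambda_N$ a minimizer of $\Lambda_N$. An $N$-cluster is a family $(E_1,\dots,E_N)$ of measurable subsets of $\Omega$ with $|E_i|>0$ for all $i$ and $|E_i\cap E_j|=0$ for $i\ne j$. Let $H_N=\inf\sum_{i=1}^N \mathrm{Per}(E_i)/|E_i|$ over all $N$-clusters. A Cheeger $N$-cluster is an $N$-cluster attaining $H_N$. Then: (1) $\Lambda_N=H_N<\infty$. (2) An admissible $u$ is a minimizer of $\Lambda_N$ if and only if for almost every $(t_1,\dots,t_N)\in(0,\infty)^N$ (with respect to $N$-dimensional Lebesgue measure) such that $|\{u^i>t_i\}|>0$ for all $i$, the family $(\{u^1>t_1\},\dots,\{u^N>t_N\})$ is a Cheeger $N$-cluster, where $\{u^i>t_i\}=\{x\in\Omega : u^i(x)>t_i\}$. (3) If $(E_1,\dots,E_N)$ is a Cheeger $N$-cluster, then $\left(\frac{1}{|E_1|}\mathbf 1_{E_1},\dots,\frac{1}{|E_N|}\mathbf 1_{E_N}\right)$ is a minimizer of $\Lambda_N$. -/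

import Mathlib

open MeasureTheory
open scoped ENNReal

namespace CheegerCluster

noncomputable section

/-- The divergence `∑ⱼ ∂ⱼ φʲ` of a vector field on `ℝⁿ`. -/
def divergence {n : ℕ} (φ : EuclideanSpace ℝ (Fin n) → EuclideanSpace ℝ (Fin n))
    (x : EuclideanSpace ℝ (Fin n)) : ℝ :=
  ∑ j : Fin n, (fderiv ℝ φ x (EuclideanSpace.single j 1)) j

/-- The total variation `|Du|(ℝⁿ)` of an integrable function `u : ℝⁿ → ℝ`: the supremum of
`∫ u div φ` over all `φ ∈ C_c^∞(ℝⁿ; ℝⁿ)` with `|φ| ≤ 1`. The admissible `φ` include `0` and are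
closed under `φ ↦ -φ`, so the truncation of negative values by `ENNReal.ofReal` is harmless. -/
def totalVariation {n : ℕ} (u : EuclideanSpace ℝ (Fin n) → ℝ) : ℝ≥0∞ :=
  ⨆ (φ : EuclideanSpace ℝ (Fin n) → EuclideanSpace ℝ (Fin n)) (_ : ContDiff ℝ ((⊤ : ℕ∞) : WithTop ℕ∞) φ)
    (_ : HasCompactSupport φ) (_ : ∀ x, ‖φ x‖ ≤ 1),
    ENNReal.ofReal (∫ x, u x * divergence φ x)

/-- The distributional perimeter in `ℝⁿ`, i.e. `|D 1_E|(ℝⁿ)`. -/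
def perimeter {n : ℕ} (E : Set (EuclideanSpace ℝ (Fin n))) : ℝ≥0∞ :=
  totalVariation (E.indicator fun _ => (1 : ℝ))

/-- `u ∈ BV₀(Ω)`: `u ∈ BV(ℝⁿ)` and `u = 0` almost everywhere on `ℝⁿ ∖ Ω`. For `Ω` bounded with
Lipschitz boundary this is `BV(Ω)`, functions being extended by zero. -/
structure IsBV {n : ℕ} (Ω : Set (EuclideanSpace ℝ (Fin n)))
    (u : EuclideanSpace ℝ (Fin n) → ℝ) : Prop where
  integrable : Integrable u
  totalVariation_ne_top : totalVariation u ≠ ∞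
  eq_zero : ∀ᵐ x, x ∉ Ω → u x = 0

/-- The union `Σ` of the nonnegative coordinate half-axes of `ℝᴺ`. -/
def axes (N : ℕ) : Set (EuclideanSpace ℝ (Fin N)) :=
  ⋃ i : Fin N, {y | ∃ t : ℝ, 0 ≤ t ∧ y = t • EuclideanSpace.single i (1 : ℝ)}

/-- The energy `∑ᵢ |Duⁱ|(ℝⁿ)`. -/
def energy {n N : ℕ} (u : EuclideanSpace ℝ (Fin n) → EuclideanSpace ℝ (Fin N)) : ℝ≥0∞ :=
  ∑ i : Fin N, totalVariation fun x => u x i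

/-- Admissible functions of the relaxed problem: `u ∈ BV(Ω; Σ)` with `‖uⁱ‖₁ = 1` for all `i`. -/
structure IsCompetitor {n N : ℕ} (Ω : Set (EuclideanSpace ℝ (Fin n)))
    (u : EuclideanSpace ℝ (Fin n) → EuclideanSpace ℝ (Fin N)) : Prop where
  isBV : ∀ i, IsBV Ω fun x => u x i
  mem_axes : ∀ᵐ x, x ∈ Ω → u x ∈ axes N
  norm_eq_one : ∀ i, eLpNorm (fun x => u x i) 1 volume = 1

/-- `Λ_N(Ω)`. -/
def relaxedConstant {n : ℕ} (N : ℕ) (Ω : Set (EuclideanSpace ℝ (Fin n))) : ℝ≥0∞ :=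
  ⨅ (u : EuclideanSpace ℝ (Fin n) → EuclideanSpace ℝ (Fin N)) (_ : IsCompetitor Ω u), energy u

/-- `u` is a minimizer of the relaxed problem. -/
def IsRelaxedMinimizer {n N : ℕ} (Ω : Set (EuclideanSpace ℝ (Fin n)))
    (u : EuclideanSpace ℝ (Fin n) → EuclideanSpace ℝ (Fin N)) : Prop :=
  IsCompetitor Ω u ∧ energy u = relaxedConstant N Ω

/-- An `N`-cluster in `Ω`: `N` Lebesgue measurable subsets of `Ω` of positive measure with
pairwise negligible intersections. -/
structure IsCluster {n N : ℕ} (Ω : Set (EuclideanSpace ℝ (Fin n)))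
    (E : Fin N → Set (EuclideanSpace ℝ (Fin n))) : Prop where
  measurable : ∀ i, NullMeasurableSet (E i) volume
  subset : ∀ i, E i ⊆ Ω
  volume_pos : ∀ i, 0 < volume (E i)
  disjoint : ∀ i j, i ≠ j → volume (E i ∩ E j) = 0

/-- The functional `∑ᵢ Per(Eᵢ) / |Eᵢ|`. -/
def cheegerQuotient {n N : ℕ} (E : Fin N → Set (EuclideanSpace ℝ (Fin n))) : ℝ≥0∞ :=
  ∑ i : Fin N, perimeter (E i) / volume (E i)

/-- `H_N(Ω)`. -/
def cheegerConstant {n : ℕ} (N : ℕ) (Ω : Set (EuclideanSpace ℝ (Fin n))) : ℝ≥0∞ :=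
  ⨅ (E : Fin N → Set (EuclideanSpace ℝ (Fin n))) (_ : IsCluster Ω E), cheegerQuotient E

/-- A Cheeger `N`-cluster: an `N`-cluster attaining `H_N(Ω)`. -/
def IsCheegerCluster {n N : ℕ} (Ω : Set (EuclideanSpace ℝ (Fin n)))
    (E : Fin N → Set (EuclideanSpace ℝ (Fin n))) : Prop :=
  IsCluster Ω E ∧ cheegerQuotient E = cheegerConstant N Ω

/-- The superlevel sets `{uⁱ > tᵢ} = {x ∈ Ω ; uⁱ(x) > tᵢ}`. -/
def superlevel {n N : ℕ} (Ω : Set (EuclideanSpace ℝ (Fin n)))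
    (u : EuclideanSpace ℝ (Fin n) → EuclideanSpace ℝ (Fin N)) (t : Fin N → ℝ) (i : Fin N) :
    Set (EuclideanSpace ℝ (Fin n)) :=
  {x | x ∈ Ω ∧ t i < u x i}

/-- The function `(|E₁|⁻¹ 1_{E₁}, …, |E_N|⁻¹ 1_{E_N})`. -/
def normalizedIndicators {n N : ℕ} (E : Fin N → Set (EuclideanSpace ℝ (Fin n)))
    (x : EuclideanSpace ℝ (Fin n)) : EuclideanSpace ℝ (Fin N) :=
  WithLp.toLp 2 fun i => (E i).indicator (fun _ => ((volume (E i)).toReal)⁻¹) x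

end

end CheegerCluster

/-!
The theorem rests on the coarea formula `|Du|(ℝⁿ) = ∫₀^∞ Per({u > t}) dt` for nonnegative
`u ∈ BV(ℝⁿ)` (`coarea`). Let `u` be a competitor. Since `‖uⁱ‖₁ = 1`, the layer cake formula says
that `|{uⁱ > t}| dt` is a probability measure on `(0, ∞)`, so `∏ᵢ |{uⁱ > tᵢ}| dt` is a probability
measure `ν` on `(0, ∞)ᴺ`. By the coarea formula, the `ν`-average of the Cheeger quotient
`∑ᵢ Per({uⁱ > tᵢ}) / |{uⁱ > tᵢ}|` is the energy of `u`
(`IsCompetitor.exists_measure_lintegral_cheegerQuotient`). For `ν`-almost every `t` the superlevel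
sets form a cluster, because `u` takes its values in the half-axes, and their quotient is therefore
at least `H_N`. Averaging gives `H_N ≤ Λ_N`, and `u` has energy `H_N` exactly when the quotient
equals `H_N` for `ν`-almost every `t`. Conversely, the normalized indicators of a cluster have
energy at most its Cheeger quotient, which gives `Λ_N ≤ H_N` and the last assertion. Finiteness
follows by taking bump functions with disjoint supports.

For the coarea formula, `≤` is the layer cake decomposition of `u` tested against a vector field
(`totalVariation_le_lintegral_perimeter`). For `≥`, the indicator function of `(t, ∞)` is replaced
by a smooth ramp: for smooth `v` the inequality `∫ |D(ramp (v - t))| dt ≤ |Dv|` is Tonelli's theorem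
and the chain rule. It passes to `u` by mollification, which does not increase the total variation
(`totalVariation_convolution_le`), and then from ramps to indicator functions, both times by Fatou's
lemma and the lower semicontinuity of the total variation under bounded almost everywhere
convergence (`totalVariation_le_liminf`).
-/

namespace CheegerCluster

open Filter Set Topology

variable {n N : ℕ}

/-! ### Test fields and elementary properties of the total variation -/

/-- The vector fields over which the supremum defining `totalVariation` is taken. -/
structure IsTestField (φ : EuclideanSpace ℝ (Fin n) → EuclideanSpace ℝ (Fin n)) : Prop where
  contDiff : ContDiff ℝ ((⊤ : ℕ∞) : WithTop ℕ∞) φ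
  hasCompactSupport : HasCompactSupport φ
  norm_le_one : ∀ x, ‖φ x‖ ≤ 1

theorem IsTestField.ofReal_integral_le {φ : EuclideanSpace ℝ (Fin n) → EuclideanSpace ℝ (Fin n)}
    (hφ : IsTestField φ) (u : EuclideanSpace ℝ (Fin n) → ℝ) :
    ENNReal.ofReal (∫ x, u x * divergence φ x) ≤ totalVariation u :=
  le_iSup_of_le φ <| le_iSup_of_le hφ.contDiff <| le_iSup_of_le hφ.hasCompactSupport <|
    le_iSup_of_le hφ.norm_le_one le_rfl

theorem totalVariation_le {u : EuclideanSpace ℝ (Fin n) → ℝ} {c : ℝ≥0∞}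
    (h : ∀ φ, IsTestField φ → ENNReal.ofReal (∫ x, u x * divergence φ x) ≤ c) :
    totalVariation u ≤ c :=
  iSup_le fun φ => iSup_le fun h1 => iSup_le fun h2 => iSup_le fun h3 => h φ ⟨h1, h2, h3⟩

theorem continuous_divergence {φ : EuclideanSpace ℝ (Fin n) → EuclideanSpace ℝ (Fin n)}
    (hφ : ContDiff ℝ ((⊤ : ℕ∞) : WithTop ℕ∞) φ) : Continuous (divergence φ) := by
  have := hφ.continuous_fderiv (by simp)
  unfold divergence
  fun_prop

theorem hasCompactSupport_divergence {φ : EuclideanSpace ℝ (Fin n) → EuclideanSpace ℝ (Fin n)}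
    (hφ : HasCompactSupport φ) : HasCompactSupport (divergence φ) := by
  have h := hφ.fderiv ℝ
  exact h.comp_left (g := fun L : EuclideanSpace ℝ (Fin n) →L[ℝ] EuclideanSpace ℝ (Fin n) =>
    ∑ j : Fin n, (L (EuclideanSpace.single j 1)) j) (by simp)

theorem IsTestField.continuous_divergence
    {φ : EuclideanSpace ℝ (Fin n) → EuclideanSpace ℝ (Fin n)} (hφ : IsTestField φ) :
    Continuous (divergence φ) := CheegerCluster.continuous_divergence hφ.contDiff

theorem IsTestField.integrable_divergence
    {φ : EuclideanSpace ℝ (Fin n) → EuclideanSpace ℝ (Fin n)} (hφ : IsTestField φ) :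
    Integrable (divergence φ) :=
  hφ.continuous_divergence.integrable_of_hasCompactSupport
    (hasCompactSupport_divergence hφ.hasCompactSupport)

theorem IsTestField.exists_bound_divergence
    {φ : EuclideanSpace ℝ (Fin n) → EuclideanSpace ℝ (Fin n)} (hφ : IsTestField φ) :
    ∃ C, ∀ x, ‖divergence φ x‖ ≤ C :=
  (hasCompactSupport_divergence hφ.hasCompactSupport).exists_bound_of_continuous
    hφ.continuous_divergence

theorem IsTestField.translate {φ : EuclideanSpace ℝ (Fin n) → EuclideanSpace ℝ (Fin n)}
    (hφ : IsTestField φ) (y : EuclideanSpace ℝ (Fin n)) : IsTestField fun x => φ (x + y) where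
  contDiff := hφ.contDiff.comp (contDiff_id.add contDiff_const)
  hasCompactSupport := hφ.hasCompactSupport.comp_homeomorph (Homeomorph.addRight y)
  norm_le_one _ := hφ.norm_le_one _

theorem divergence_translate (φ : EuclideanSpace ℝ (Fin n) → EuclideanSpace ℝ (Fin n))
    (x y : EuclideanSpace ℝ (Fin n)) :
    divergence (fun x => φ (x + y)) x = divergence φ (x + y) := by
  simp [divergence, fderiv_comp_add_right]

theorem totalVariation_congr_ae {u v : EuclideanSpace ℝ (Fin n) → ℝ} (h : u =ᵐ[volume] v) :
    totalVariation u = totalVariation v := by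
  have : ∀ φ : EuclideanSpace ℝ (Fin n) → EuclideanSpace ℝ (Fin n),
      ∫ x, u x * divergence φ x = ∫ x, v x * divergence φ x := fun φ =>
    integral_congr_ae (by filter_upwards [h] with x hx; rw [hx])
  simp only [totalVariation, this]

theorem perimeter_congr_ae {A B : Set (EuclideanSpace ℝ (Fin n))} (h : A =ᵐ[volume] B) :
    perimeter A = perimeter B :=
  totalVariation_congr_ae (indicator_ae_eq_of_ae_eq_set h)

theorem perimeter_eq_zero_of_volume_eq_zero {A : Set (EuclideanSpace ℝ (Fin n))}
    (h : volume A = 0) : perimeter A = 0 := by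
  rw [perimeter_congr_ae (ae_eq_empty.2 h), perimeter, ← nonpos_iff_eq_zero]
  exact totalVariation_le fun φ _ => by simp

theorem totalVariation_const_mul_le {c : ℝ} (hc : 0 ≤ c) (u : EuclideanSpace ℝ (Fin n) → ℝ) :
    totalVariation (fun x => c * u x) ≤ ENNReal.ofReal c * totalVariation u := by
  refine totalVariation_le fun φ hφ => ?_
  simp only [mul_assoc, integral_const_mul]
  rw [ENNReal.ofReal_mul hc]
  gcongr
  exact hφ.ofReal_integral_le u

/-- Lower semicontinuity of the total variation under bounded almost everywhere convergence. -/
theorem totalVariation_le_liminf {f : ℕ → EuclideanSpace ℝ (Fin n) → ℝ}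
    {g : EuclideanSpace ℝ (Fin n) → ℝ} (hf : ∀ k, AEStronglyMeasurable (f k) volume)
    (hb : ∀ k x, ‖f k x‖ ≤ 1) (h : ∀ᵐ x, Tendsto (fun k => f k x) atTop (𝓝 (g x))) :
    totalVariation g ≤ liminf (fun k => totalVariation (f k)) atTop := by
  refine totalVariation_le fun φ hφ => ?_
  have hlim : Tendsto (fun k => ∫ x, f k x * divergence φ x) atTop
      (𝓝 (∫ x, g x * divergence φ x)) := by
    refine tendsto_integral_of_dominated_convergence (fun x => ‖divergence φ x‖)
      (fun k => (hf k).mul hφ.continuous_divergence.aestronglyMeasurable)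
      hφ.integrable_divergence.norm (fun k => Eventually.of_forall fun x => ?_) ?_
    · rw [norm_mul]
      exact mul_le_of_le_one_left (norm_nonneg _) (hb k x)
    · filter_upwards [h] with x hx using hx.mul_const _
  rw [← ((ENNReal.continuous_ofReal.tendsto _).comp hlim).liminf_eq]
  exact liminf_le_liminf (Eventually.of_forall fun k => hφ.ofReal_integral_le (f k))

/-! ### Smooth functions -/

/-- The gradient of a function on `ℝⁿ`, in coordinates. -/
noncomputable def grad (v : EuclideanSpace ℝ (Fin n) → ℝ) (x : EuclideanSpace ℝ (Fin n)) :
    EuclideanSpace ℝ (Fin n) :=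
  WithLp.toLp 2 fun j => fderiv ℝ v x (EuclideanSpace.single j 1)

theorem contDiff_grad {v : EuclideanSpace ℝ (Fin n) → ℝ}
    (hv : ContDiff ℝ ((⊤ : ℕ∞) : WithTop ℕ∞) v) :
    ContDiff ℝ ((⊤ : ℕ∞) : WithTop ℕ∞) (grad v) := by
  refine contDiff_euclidean.2 fun j => ?_
  exact (hv.fderiv_right (m := ((⊤ : ℕ∞) : WithTop ℕ∞)) (by simp)).clm_apply contDiff_const

/-- The divergence theorem for the product of a smooth function and a test field. -/
theorem integral_mul_divergence {v : EuclideanSpace ℝ (Fin n) → ℝ}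
    {φ : EuclideanSpace ℝ (Fin n) → EuclideanSpace ℝ (Fin n)}
    (hv : ContDiff ℝ ((⊤ : ℕ∞) : WithTop ℕ∞) v)
    (hφ : ContDiff ℝ ((⊤ : ℕ∞) : WithTop ℕ∞) φ) (hc : HasCompactSupport φ) :
    ∫ x, v x * divergence φ x = -∫ x, inner ℝ (grad v x) (φ x) := by
  have hvc := hv.continuous
  have hφc := hφ.continuous
  have hdv := hv.continuous_fderiv (by simp)
  have hdφ := hφ.continuous_fderiv (by simp)
  have hcj : ∀ j, HasCompactSupport fun x => φ x j := fun j =>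
    hc.comp_left (g := fun y : EuclideanSpace ℝ (Fin n) => y j) rfl
  have hcdj : ∀ j, HasCompactSupport fun x => fderiv ℝ φ x (EuclideanSpace.single j 1) j := fun j =>
    (hc.fderiv ℝ).comp_left
      (g := fun L : EuclideanSpace ℝ (Fin n) →L[ℝ] EuclideanSpace ℝ (Fin n) =>
        (L (EuclideanSpace.single j 1)) j) rfl
  have hder : ∀ j x, fderiv ℝ (fun x => φ x j) x = (EuclideanSpace.proj j).comp (fderiv ℝ φ x) :=
    fun j x => ((EuclideanSpace.proj j : EuclideanSpace ℝ (Fin n) →L[ℝ] ℝ).hasFDerivAt.comp x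
      (hφ.differentiable (by simp) x).hasFDerivAt).fderiv
  have i1 : ∀ j, Integrable fun x => v x * fderiv ℝ φ x (EuclideanSpace.single j 1) j := fun j =>
    Continuous.integrable_of_hasCompactSupport (by fun_prop) (hcdj j).mul_left
  have i2 : ∀ j, Integrable fun x => fderiv ℝ v x (EuclideanSpace.single j 1) * φ x j := fun j =>
    Continuous.integrable_of_hasCompactSupport (by fun_prop) (hcj j).mul_left
  have i3 : ∀ j, Integrable fun x => v x * φ x j := fun j =>
    Continuous.integrable_of_hasCompactSupport (by fun_prop) (hcj j).mul_left
  have key : ∀ j, ∫ x, v x * fderiv ℝ φ x (EuclideanSpace.single j 1) j =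
      -∫ x, fderiv ℝ v x (EuclideanSpace.single j 1) * φ x j := fun j => by
    have := integral_mul_fderiv_eq_neg_fderiv_mul_of_integrable (μ := volume) (f := v)
      (g := fun x => φ x j) (v := EuclideanSpace.single j 1) (i2 j)
      (by simpa [hder] using i1 j) (i3 j)
      (fun x _ => hv.differentiable (by simp) x)
      (fun x _ => ((EuclideanSpace.proj j : EuclideanSpace ℝ (Fin n) →L[ℝ] ℝ).hasFDerivAt.comp x
        (hφ.differentiable (by simp) x).hasFDerivAt).differentiableAt)
    simpa [hder] using this
  simp only [divergence, Finset.mul_sum]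
  rw [integral_finsetSum _ fun j _ => i1 j]
  simp only [key, Finset.sum_neg_distrib]
  rw [← integral_finsetSum _ fun j _ => i2 j]
  simp [grad, PiLp.inner_apply, mul_comm]

theorem totalVariation_le_lintegral_grad {v : EuclideanSpace ℝ (Fin n) → ℝ}
    (hv : ContDiff ℝ ((⊤ : ℕ∞) : WithTop ℕ∞) v) :
    totalVariation v ≤ ∫⁻ x, ‖grad v x‖ₑ := by
  refine totalVariation_le fun φ hφ => ?_
  rw [integral_mul_divergence hv hφ.contDiff hφ.hasCompactSupport, ← integral_neg]
  calc ENNReal.ofReal (∫ x, -inner ℝ (grad v x) (φ x))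
      ≤ ENNReal.ofReal ‖∫ x, -inner ℝ (grad v x) (φ x)‖ :=
        ENNReal.ofReal_le_ofReal (Real.le_norm_self _)
    _ = ‖∫ x, -inner ℝ (grad v x) (φ x)‖ₑ := ofReal_norm _
    _ ≤ ∫⁻ x, ‖-inner ℝ (grad v x) (φ x)‖ₑ := enorm_integral_le_lintegral_enorm _
    _ ≤ ∫⁻ x, ‖grad v x‖ₑ := by
        refine lintegral_mono fun x => ?_
        rw [enorm_neg, enorm_le_iff_norm_le]
        exact (norm_inner_le_norm _ _).trans
          (mul_le_of_le_one_right (norm_nonneg _) (hφ.norm_le_one x))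

/-- The total variation of a smooth function controls `∫ |∇v|`: test with the fields
`-χ ∇v / √(δ² + |∇v|²)`, `χ` being a cutoff function. -/
theorem lintegral_grad_le_totalVariation {v : EuclideanSpace ℝ (Fin n) → ℝ}
    (hv : ContDiff ℝ ((⊤ : ℕ∞) : WithTop ℕ∞) v) :
    ∫⁻ x, ‖grad v x‖ₑ ≤ totalVariation v := by
  have hg := contDiff_grad hv
  let χ : ℕ → ContDiffBump (0 : EuclideanSpace ℝ (Fin n)) := fun k =>
    ⟨k + 1, k + 2, by positivity, by linarith⟩
  let δ : ℕ → ℝ := fun k => 1 / ((k : ℝ) + 1)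
  have hδ : ∀ k, 0 < δ k := fun k => by positivity
  let q : ℕ → EuclideanSpace ℝ (Fin n) → ℝ := fun k x => Real.sqrt (δ k ^ 2 + ‖grad v x‖ ^ 2)
  have hqpos : ∀ k x, 0 < q k x := fun k x => Real.sqrt_pos.2 (by have := hδ k; positivity)
  have hgq : ∀ k x, ‖grad v x‖ ≤ q k x := fun k x =>
    Real.le_sqrt_of_sq_le (by have := hδ k; nlinarith)
  have hqsmooth : ∀ k, ContDiff ℝ ((⊤ : ℕ∞) : WithTop ℕ∞) (q k) := fun k =>
    (contDiff_const.add (hg.norm_sq ℝ)).sqrt fun x => by have := hδ k; positivity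
  let φ : ℕ → EuclideanSpace ℝ (Fin n) → EuclideanSpace ℝ (Fin n) := fun k x =>
    (-(χ k x * (q k x)⁻¹)) • grad v x
  have hφ : ∀ k, IsTestField (φ k) := fun k =>
    { contDiff :=
        (((χ k).contDiff).mul ((hqsmooth k).inv fun x => (hqpos k x).ne')).neg.smul hg
      hasCompactSupport :=
        ((χ k).hasCompactSupport.mul_right (f' := fun x => (q k x)⁻¹)).neg.smul_right
      norm_le_one := fun x => by
        rw [norm_smul, norm_neg, norm_mul, norm_inv, Real.norm_of_nonneg (χ k).nonneg,
          Real.norm_of_nonneg (hqpos k x).le, mul_assoc]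
        refine mul_le_one₀ (χ k).le_one (by have := hqpos k x; positivity) ?_
        rw [inv_mul_le_one₀ (hqpos k x)]
        exact hgq k x }
  let F : ℕ → EuclideanSpace ℝ (Fin n) → ℝ := fun k x => χ k x * (q k x)⁻¹ * ‖grad v x‖ ^ 2
  have hF0 : ∀ k x, 0 ≤ F k x := fun k x => by
    have := hqpos k x; have := (χ k).nonneg (x := x); positivity
  have hFc : ∀ k, Continuous (F k) := fun k =>
    (((χ k).continuous).mul ((hqsmooth k).continuous.inv₀ fun x => (hqpos k x).ne')).mul
      (hg.continuous.norm.pow 2)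
  have hFi : ∀ k, Integrable (F k) := fun k =>
    (hFc k).integrable_of_hasCompactSupport
      (((χ k).hasCompactSupport.mul_right (f' := fun x => (q k x)⁻¹)).mul_right)
  have hle : ∀ k, ∫⁻ x, ENNReal.ofReal (F k x) ≤ totalVariation v := fun k => by
    rw [← ofReal_integral_eq_lintegral_ofReal (hFi k) (Eventually.of_forall (hF0 k))]
    refine le_of_eq_of_le ?_ ((hφ k).ofReal_integral_le v)
    rw [integral_mul_divergence hv (hφ k).contDiff (hφ k).hasCompactSupport, ← integral_neg]
    congr 2 with x
    simp [φ, F, inner_smul_right]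
  have hlim : ∀ x, Tendsto (fun k => ENNReal.ofReal (F k x)) atTop (𝓝 ‖grad v x‖ₑ) := fun x => by
    rw [← ofReal_norm]
    refine (ENNReal.continuous_ofReal.tendsto _).comp ?_
    have hχ : ∀ᶠ k : ℕ in atTop, χ k x = 1 := by
      obtain ⟨K, hK⟩ := exists_nat_ge ‖x‖
      filter_upwards [eventually_ge_atTop K] with k hk
      refine (χ k).one_of_mem_closedBall ?_
      have : (K : ℝ) ≤ k := by exact_mod_cast hk
      simp only [mem_closedBall_zero_iff, χ]
      linarith
    rcases eq_or_ne (grad v x) 0 with h0 | h0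
    · simp [F, h0]
    have hq : Tendsto (fun k => q k x) atTop (𝓝 ‖grad v x‖) := by
      have h1 : Tendsto δ atTop (𝓝 0) := tendsto_one_div_add_atTop_nhds_zero_nat
      have h2 : Tendsto (fun k => Real.sqrt (δ k ^ 2 + ‖grad v x‖ ^ 2)) atTop
          (𝓝 (Real.sqrt (0 ^ 2 + ‖grad v x‖ ^ 2))) :=
        (Real.continuous_sqrt.tendsto _).comp ((h1.pow 2).add_const _)
      simpa using h2
    have h3 := (hq.inv₀ (norm_ne_zero_iff.2 h0)).mul_const (‖grad v x‖ ^ 2)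
    have h4 : ‖grad v x‖⁻¹ * ‖grad v x‖ ^ 2 = ‖grad v x‖ := by
      field_simp
    rw [h4] at h3
    refine h3.congr' ?_
    filter_upwards [hχ] with k hk
    simp [F, hk]
  calc ∫⁻ x, ‖grad v x‖ₑ = ∫⁻ x, liminf (fun k => ENNReal.ofReal (F k x)) atTop :=
        lintegral_congr fun x => (hlim x).liminf_eq.symm
    _ ≤ liminf (fun k => ∫⁻ x, ENNReal.ofReal (F k x)) atTop :=
        lintegral_liminf_le fun k => (hFc k).measurable.ennreal_ofReal
    _ ≤ totalVariation v := liminf_le_of_le (by isBoundedDefault) fun b hb => by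
        obtain ⟨k, hk⟩ := hb.exists
        exact hk.trans (hle k)

/-- Mollification does not increase the total variation, because a translate of a test field
is again a test field. -/
theorem totalVariation_convolution_le (ρ : ContDiffBump (0 : EuclideanSpace ℝ (Fin n)))
    {u : EuclideanSpace ℝ (Fin n) → ℝ} (hu : Integrable u) :
    totalVariation (convolution (ρ.normed volume) u (ContinuousLinearMap.lsmul ℝ ℝ) volume) ≤
      totalVariation u := by
  rcases eq_or_ne (totalVariation u) ∞ with htop | htop
  · rw [htop]; exact le_top
  refine totalVariation_le fun φ hφ => ?_
  set r := ρ.normed volume with hr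
  have hri : Integrable r := ρ.integrable_normed
  obtain ⟨C, hC⟩ := hφ.exists_bound_divergence
  have hcI : Integrable (fun p : EuclideanSpace ℝ (Fin n) × EuclideanSpace ℝ (Fin n) =>
      r p.2 * u (p.1 - p.2) * divergence φ p.1) (volume.prod volume) := by
    have := hri.convolution_integrand (ContinuousLinearMap.lsmul ℝ ℝ) hu
    simp only [ContinuousLinearMap.lsmul_apply, smul_eq_mul] at this
    exact this.mul_bdd (c := C) (hφ.continuous_divergence.comp continuous_fst).aestronglyMeasurable
      (Eventually.of_forall fun p => hC _)
  have hshift : ∀ y, ∫ x, u (x - y) * divergence φ x = ∫ x, u x * divergence φ (x + y) := fun y => by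
    rw [← integral_sub_right_eq_self (fun x => u x * divergence φ (x + y)) y]
    simp
  have hswap : ∫ x, convolution r u (ContinuousLinearMap.lsmul ℝ ℝ) volume x * divergence φ x =
      ∫ y, r y * ∫ x, u x * divergence φ (x + y) := by
    calc _ = ∫ x, ∫ y, r y * u (x - y) * divergence φ x := by
          simp only [convolution_def, ContinuousLinearMap.lsmul_apply, smul_eq_mul,
            integral_mul_const]
      _ = ∫ y, ∫ x, r y * u (x - y) * divergence φ x := integral_integral_swap hcI
      _ = _ := by simp only [mul_assoc, integral_const_mul, hshift]
  have hbd : ∀ y, ∫ x, u x * divergence φ (x + y) ≤ (totalVariation u).toReal := fun y => by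
    refine (ENNReal.ofReal_le_iff_le_toReal htop).1 ?_
    simpa only [divergence_translate] using (hφ.translate y).ofReal_integral_le u
  rw [ENNReal.ofReal_le_iff_le_toReal htop, hswap]
  have hint : Integrable fun y => r y * ∫ x, u x * divergence φ (x + y) := by
    have := hcI.integral_prod_right
    simpa only [mul_assoc, integral_const_mul, hshift] using this
  calc ∫ y, r y * ∫ x, u x * divergence φ (x + y)
      ≤ ∫ y, r y * (totalVariation u).toReal :=
        integral_mono hint (hri.mul_const _) fun y =>
          mul_le_mul_of_nonneg_left (hbd y) (ρ.nonneg_normed y)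
    _ = (totalVariation u).toReal := by
        rw [integral_mul_const, hr, ρ.integral_normed, one_mul]

/-! ### The coarea formula -/

/-- A smooth nondecreasing approximation of the indicator function of `(0, ∞)`: it vanishes on
`(-∞, 0]` and equals `1` on `[m⁻¹, ∞)`. -/
noncomputable def ramp (m s : ℝ) : ℝ := Real.smoothTransition (m * s)

theorem contDiff_ramp (m : ℝ) : ContDiff ℝ ((⊤ : ℕ∞) : WithTop ℕ∞) (ramp m) :=
  Real.smoothTransition.contDiff.comp (contDiff_const.mul contDiff_id)

theorem norm_ramp_le_one (m s : ℝ) : ‖ramp m s‖ ≤ 1 := by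
  rw [ramp, Real.norm_of_nonneg (Real.smoothTransition.nonneg _)]
  exact Real.smoothTransition.le_one _

theorem monotone_ramp {m : ℝ} (hm : 0 ≤ m) : Monotone (ramp m) := fun _ _ h =>
  Real.smoothTransition.monotone (mul_le_mul_of_nonneg_left h hm)

theorem ramp_of_nonpos {m s : ℝ} (hm : 0 ≤ m) (hs : s ≤ 0) : ramp m s = 0 :=
  Real.smoothTransition.zero_of_nonpos (mul_nonpos_of_nonneg_of_nonpos hm hs)

theorem ramp_of_inv_le {m s : ℝ} (hm : 0 < m) (hs : m⁻¹ ≤ s) : ramp m s = 1 :=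
  Real.smoothTransition.one_of_one_le ((inv_le_iff_one_le_mul₀' hm).1 hs)

theorem lintegral_deriv_ramp {m : ℝ} (hm : 0 < m) : ∫⁻ s, ‖deriv (ramp m) s‖ₑ = 1 := by
  have hd := contDiff_ramp m
  have hdc : Continuous (deriv (ramp m)) := hd.continuous_deriv (by simp)
  have hcs : HasCompactSupport (deriv (ramp m)) := by
    refine HasCompactSupport.intro (isCompact_Icc (a := 0) (b := m⁻¹)) fun s hs => ?_
    rw [mem_Icc, not_and_or, not_le, not_le] at hs
    rcases hs with hs | hs
    · have : ramp m =ᶠ[𝓝 s] fun _ => 0 := by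
        filter_upwards [Iio_mem_nhds hs] with y hy using ramp_of_nonpos hm.le (le_of_lt hy)
      rw [this.deriv_eq, deriv_const]
    · have : ramp m =ᶠ[𝓝 s] fun _ => 1 := by
        filter_upwards [Ioi_mem_nhds hs] with y hy using ramp_of_inv_le hm (le_of_lt hy)
      rw [this.deriv_eq, deriv_const]
  have hi : Integrable (deriv (ramp m)) := hdc.integrable_of_hasCompactSupport hcs
  have h0 : Tendsto (ramp m) atBot (𝓝 0) := by
    refine tendsto_const_nhds.congr' ?_
    filter_upwards [eventually_le_atBot 0] with y hy using (ramp_of_nonpos hm.le hy).symm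
  have h1 : Tendsto (ramp m) atTop (𝓝 1) := by
    refine tendsto_const_nhds.congr' ?_
    filter_upwards [eventually_ge_atTop m⁻¹] with y hy using (ramp_of_inv_le hm hy).symm
  have hFTC := integral_of_hasDerivAt_of_tendsto
    (fun x => (hd.differentiable (by simp) x).hasDerivAt) hi h0 h1
  have hnn : ∀ s, 0 ≤ deriv (ramp m) s := fun s => (monotone_ramp hm.le).deriv_nonneg
  calc ∫⁻ s, ‖deriv (ramp m) s‖ₑ = ∫⁻ s, ENNReal.ofReal (deriv (ramp m) s) :=
        lintegral_congr fun s => Real.enorm_of_nonneg (hnn s)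
    _ = 1 := by
        rw [← ofReal_integral_eq_lintegral_ofReal hi (Eventually.of_forall hnn), hFTC]
        simp

theorem grad_ramp_comp {v : EuclideanSpace ℝ (Fin n) → ℝ}
    (hv : ContDiff ℝ ((⊤ : ℕ∞) : WithTop ℕ∞) v) (m t : ℝ) (x : EuclideanSpace ℝ (Fin n)) :
    grad (fun y => ramp m (v y - t)) x = deriv (ramp m) (v x - t) • grad v x := by
  have h1 : HasFDerivAt (fun y => v y - t) (fderiv ℝ v x) x :=
    (hv.differentiable (by simp) x).hasFDerivAt.sub_const t
  have h2 : HasDerivAt (ramp m) (deriv (ramp m) (v x - t)) (v x - t) :=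
    ((contDiff_ramp m).differentiable (by simp) _).hasDerivAt
  have h3 := (h2.comp_hasFDerivAt x h1).fderiv
  ext j
  simp only [grad]
  rw [show (fun y => ramp m (v y - t)) = ramp m ∘ fun y => v y - t from rfl, h3]
  simp

theorem lintegral_totalVariation_ramp_le_of_contDiff {v : EuclideanSpace ℝ (Fin n) → ℝ}
    (hv : ContDiff ℝ ((⊤ : ℕ∞) : WithTop ℕ∞) v) {m : ℝ} (hm : 0 < m) :
    ∫⁻ t, totalVariation (fun x => ramp m (v x - t)) ≤ totalVariation v := by
  have hdc : Continuous (deriv (ramp m)) := (contDiff_ramp m).continuous_deriv (by simp)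
  have hgc := (contDiff_grad hv).continuous
  have hvc := hv.continuous
  calc ∫⁻ t, totalVariation (fun x => ramp m (v x - t))
      ≤ ∫⁻ t, ∫⁻ x, ‖deriv (ramp m) (v x - t)‖ₑ * ‖grad v x‖ₑ := by
        refine lintegral_mono fun t => ?_
        refine (totalVariation_le_lintegral_grad
          ((contDiff_ramp m).comp (hv.sub contDiff_const))).trans_eq ?_
        refine lintegral_congr fun x => ?_
        rw [← enorm_smul, ← grad_ramp_comp hv]
        rfl
    _ = ∫⁻ x, ∫⁻ t, ‖deriv (ramp m) (v x - t)‖ₑ * ‖grad v x‖ₑ := by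
        refine lintegral_lintegral_swap (Measurable.aemeasurable ?_)
        have h1 : Measurable fun p : ℝ × EuclideanSpace ℝ (Fin n) =>
            ‖deriv (ramp m) (v p.2 - p.1)‖ₑ :=
          Measurable.enorm (Continuous.measurable (by fun_prop))
        have h2 : Measurable fun p : ℝ × EuclideanSpace ℝ (Fin n) => ‖grad v p.2‖ₑ :=
          (hgc.measurable.comp measurable_snd).enorm
        exact h1.mul h2
    _ = ∫⁻ x, ‖grad v x‖ₑ := by
        refine lintegral_congr fun x => ?_
        have h1 : Measurable fun t => ‖deriv (ramp m) (v x - t)‖ₑ :=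
          Measurable.enorm (Continuous.measurable (by fun_prop))
        rw [lintegral_mul_const _ h1,
          lintegral_sub_left_eq_self (fun s => ‖deriv (ramp m) s‖ₑ) (v x),
          lintegral_deriv_ramp hm, one_mul]
    _ ≤ totalVariation v := lintegral_grad_le_totalVariation hv

theorem aestronglyMeasurable_ramp_comp {u : EuclideanSpace ℝ (Fin n) → ℝ}
    (hu : AEStronglyMeasurable u) (m t : ℝ) :
    AEStronglyMeasurable (fun x => ramp m (u x - t)) :=
  (contDiff_ramp m).continuous.comp_aestronglyMeasurable (hu.sub aestronglyMeasurable_const)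

/-- As a supremum of continuous functions of `t`, the total variation of `ramp m (u - t)` is
lower semicontinuous in `t`. -/
theorem measurable_totalVariation_ramp {u : EuclideanSpace ℝ (Fin n) → ℝ}
    (hu : AEStronglyMeasurable u) (m : ℝ) :
    Measurable fun t => totalVariation fun x => ramp m (u x - t) := by
  refine LowerSemicontinuous.measurable ?_
  unfold totalVariation
  refine lowerSemicontinuous_iSup fun φ => lowerSemicontinuous_iSup fun h1 =>
    lowerSemicontinuous_iSup fun h2 => lowerSemicontinuous_iSup fun h3 => ?_
  have hφ : IsTestField φ := ⟨h1, h2, h3⟩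
  refine (ENNReal.continuous_ofReal.comp ?_).lowerSemicontinuous
  refine continuous_of_dominated (bound := fun x => ‖divergence φ x‖)
    (fun t => (aestronglyMeasurable_ramp_comp hu m t).mul
      hφ.continuous_divergence.aestronglyMeasurable)
    (fun t => Eventually.of_forall fun x => ?_) hφ.integrable_divergence.norm
    (Eventually.of_forall fun x => ?_)
  · rw [norm_mul]
    exact mul_le_of_le_one_left (norm_nonneg _) (norm_ramp_le_one _ _)
  · have := (contDiff_ramp m).continuous
    fun_prop

theorem lintegral_totalVariation_ramp_le {u : EuclideanSpace ℝ (Fin n) → ℝ}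
    (hu : Integrable u) {m : ℝ} (hm : 0 < m) :
    ∫⁻ t, totalVariation (fun x => ramp m (u x - t)) ≤ totalVariation u := by
  let ρ : ℕ → ContDiffBump (0 : EuclideanSpace ℝ (Fin n)) := fun k =>
    ⟨1 / ((k : ℝ) + 1), 2 * (1 / ((k : ℝ) + 1)), by positivity, by
      have : (0 : ℝ) < 1 / ((k : ℝ) + 1) := by positivity
      linarith⟩
  let v : ℕ → EuclideanSpace ℝ (Fin n) → ℝ := fun k =>
    convolution ((ρ k).normed volume) u (ContinuousLinearMap.lsmul ℝ ℝ) volume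
  have hv : ∀ k, ContDiff ℝ ((⊤ : ℕ∞) : WithTop ℕ∞) (v k) := fun k =>
    (ρ k).hasCompactSupport_normed.contDiff_convolution_left _ (ρ k).contDiff_normed
      hu.locallyIntegrable
  have hlim : ∀ᵐ x, Tendsto (fun k => v k x) atTop (𝓝 (u x)) := by
    refine ContDiffBump.ae_convolution_tendsto_right_of_locallyIntegrable (K := 2) ?_
      (Eventually.of_forall fun k => le_rfl) hu.locallyIntegrable
    simpa [ρ] using (tendsto_one_div_add_atTop_nhds_zero_nat (𝕜 := ℝ)).const_mul 2
  calc ∫⁻ t, totalVariation (fun x => ramp m (u x - t))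
      ≤ ∫⁻ t, liminf (fun k => totalVariation (fun x => ramp m (v k x - t))) atTop := by
        refine lintegral_mono fun t => totalVariation_le_liminf
          (fun k => aestronglyMeasurable_ramp_comp (hv k).continuous.aestronglyMeasurable m t)
          (fun k x => norm_ramp_le_one _ _) ?_
        filter_upwards [hlim] with x hx
        exact ((contDiff_ramp m).continuous.tendsto _).comp (hx.sub_const t)
    _ ≤ liminf (fun k => ∫⁻ t, totalVariation (fun x => ramp m (v k x - t))) atTop :=
        lintegral_liminf_le fun k =>
          measurable_totalVariation_ramp (hv k).continuous.aestronglyMeasurable m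
    _ ≤ totalVariation u := liminf_le_of_le (by isBoundedDefault) fun b hb => by
        obtain ⟨k, hk⟩ := hb.exists
        exact hk.trans ((lintegral_totalVariation_ramp_le_of_contDiff (hv k) hm).trans
          (totalVariation_convolution_le (ρ k) hu))

theorem perimeter_superlevel_le_liminf {u : EuclideanSpace ℝ (Fin n) → ℝ}
    (hu : AEStronglyMeasurable u) (t : ℝ) :
    perimeter {x | t < u x} ≤
      liminf (fun k : ℕ => totalVariation fun x => ramp ((k : ℝ) + 1) (u x - t)) atTop := by
  refine totalVariation_le_liminf (fun k => aestronglyMeasurable_ramp_comp hu _ t)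
    (fun k x => norm_ramp_le_one _ _) (Eventually.of_forall fun x => tendsto_const_nhds.congr' ?_)
  by_cases hx : t < u x
  · obtain ⟨K, hK⟩ := exists_nat_ge (u x - t)⁻¹
    filter_upwards [eventually_ge_atTop K] with k hk
    rw [indicator_of_mem (show x ∈ {x | t < u x} from hx), ramp_of_inv_le (by positivity)]
    have : (K : ℝ) ≤ k := by exact_mod_cast hk
    exact inv_le_of_inv_le₀ (sub_pos.2 hx) (by linarith)
  · refine Eventually.of_forall fun k => ?_
    dsimp only
    rw [indicator_of_notMem (show x ∉ {x | t < u x} from hx),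
      ramp_of_nonpos (m := (k : ℝ) + 1) (by positivity) (sub_nonpos.2 (not_lt.1 hx))]

theorem ofReal_integral_le_lintegral_ofReal {α : Type*} [MeasurableSpace α] {μ : Measure α}
    {f : α → ℝ} (hf : Integrable f μ) :
    ENNReal.ofReal (∫ a, f a ∂μ) ≤ ∫⁻ a, ENNReal.ofReal (f a) ∂μ := by
  rw [integral_eq_lintegral_pos_part_sub_lintegral_neg_part hf]
  exact (ENNReal.ofReal_le_ofReal (sub_le_self _ ENNReal.toReal_nonneg)).trans
    ENNReal.ofReal_toReal_le

/-- The inequality in the coarea formula that follows from the layer cake decomposition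
`u = ∫₀^∞ 1_{u > t} dt`. -/
theorem totalVariation_le_lintegral_perimeter {u : EuclideanSpace ℝ (Fin n) → ℝ}
    (hu : Integrable u) (hu0 : 0 ≤ᵐ[volume] u) :
    totalVariation u ≤ ∫⁻ t in Ioi 0, perimeter {x | t < u x} := by
  wlog hm : Measurable u generalizing u
  · have hae := hu.1.ae_eq_mk
    have := this (u := hu.1.mk u) (hu.congr hae)
      (by filter_upwards [hae, hu0] with x hx h0; rwa [← hx])
      hu.1.stronglyMeasurable_mk.measurable
    rw [totalVariation_congr_ae hae]
    refine this.trans_eq (lintegral_congr fun t => perimeter_congr_ae ?_)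
    filter_upwards [hae] with x hx
    exact congrArg (t < ·) hx.symm
  refine totalVariation_le fun φ hφ => ?_
  obtain ⟨C, hC⟩ := hφ.exists_bound_divergence
  let ν : Measure ℝ := volume.restrict (Ioi 0)
  let S : Set (EuclideanSpace ℝ (Fin n) × ℝ) := {p | p.2 < u p.1}
  have hS : MeasurableSet S := measurableSet_lt measurable_snd (hm.comp measurable_fst)
  have hνI : ∀ a : ℝ, ν (Iio a) = ENNReal.ofReal a := fun a => by
    rw [Measure.restrict_apply measurableSet_Iio, inter_comm, Ioi_inter_Iio, Real.volume_Ioo,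
      sub_zero]
  have hSfin : (volume.prod ν) S ≠ ∞ := by
    rw [Measure.prod_apply hS]
    have : ∀ x, ν (Prod.mk x ⁻¹' S) = ENNReal.ofReal (u x) := fun x => hνI (u x)
    simp only [this]
    exact hu.lintegral_lt_top.ne
  have hI : Integrable (fun p : EuclideanSpace ℝ (Fin n) × ℝ =>
      S.indicator (fun _ => (1 : ℝ)) p * divergence φ p.1) (volume.prod ν) :=
    ((integrable_indicator_iff hS).2 (integrableOn_const hSfin)).mul_bdd (c := C)
      (hφ.continuous_divergence.comp continuous_fst).aestronglyMeasurable
      (Eventually.of_forall fun p => hC _)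
  have hlayer : ∀ᵐ x, u x * divergence φ x =
      ∫ t, S.indicator (fun _ => (1 : ℝ)) (x, t) * divergence φ x ∂ν := by
    filter_upwards [hu0] with x hx
    rw [integral_mul_const]
    congr 1
    have : (fun t => S.indicator (fun _ => (1 : ℝ)) (x, t)) = (Iio (u x)).indicator 1 := by
      ext t; simp [S, indicator]
    rw [this, integral_indicator_one measurableSet_Iio, Measure.real, hνI,
      ENNReal.toReal_ofReal hx]
  rw [integral_congr_ae hlayer, integral_integral_swap hI]
  refine (ofReal_integral_le_lintegral_ofReal hI.integral_prod_right).trans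
    (lintegral_mono fun t => ?_)
  exact hφ.ofReal_integral_le _

/-- **Coarea formula** for nonnegative functions. Measurability of the perimeter in `t` is part of
the conclusion: the upper bound comes from a measurable majorant of the perimeter, whose integral
is forced by `totalVariation_le_lintegral_perimeter` to agree with that of the perimeter. -/
theorem coarea {u : EuclideanSpace ℝ (Fin n) → ℝ} (hu : Integrable u) (hu0 : 0 ≤ᵐ[volume] u)
    (hTV : totalVariation u ≠ ∞) :
    AEMeasurable (fun t => perimeter {x | t < u x}) (volume.restrict (Ioi 0)) ∧
      ∫⁻ t in Ioi 0, perimeter {x | t < u x} = totalVariation u := by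
  set Q : ℝ → ℝ≥0∞ := fun t =>
    liminf (fun k : ℕ => totalVariation fun x => ramp ((k : ℝ) + 1) (u x - t)) atTop with hQ
  have hQm : Measurable Q :=
    Measurable.liminf fun k => measurable_totalVariation_ramp hu.1 _
  have hQi : ∫⁻ t in Ioi 0, Q t ≤ totalVariation u :=
    calc ∫⁻ t in Ioi 0, Q t ≤ ∫⁻ t, Q t := setLIntegral_le_lintegral _ _
      _ ≤ liminf (fun k : ℕ => ∫⁻ t, totalVariation fun x => ramp ((k : ℝ) + 1) (u x - t)) atTop :=
          lintegral_liminf_le fun k => measurable_totalVariation_ramp hu.1 _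
      _ ≤ totalVariation u := liminf_le_of_le (by isBoundedDefault) fun b hb => by
          obtain ⟨k, hk⟩ := hb.exists
          exact hk.trans (lintegral_totalVariation_ramp_le hu (by positivity))
  have hPQ : ∀ t, perimeter {x | t < u x} ≤ Q t := fun t => perimeter_superlevel_le_liminf hu.1 t
  have hlow := totalVariation_le_lintegral_perimeter hu hu0
  have heq : ∫⁻ t in Ioi 0, perimeter {x | t < u x} = totalVariation u :=
    le_antisymm ((lintegral_mono hPQ).trans hQi) hlow
  refine ⟨?_, heq⟩
  -- The lower integral of the perimeter is attained by a measurable minorant.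
  obtain ⟨g, hgm, hgle, hgi⟩ := exists_measurable_le_lintegral_eq (μ := volume.restrict (Ioi 0))
    fun t => perimeter {x | t < u x}
  have hgQ : g =ᵐ[volume.restrict (Ioi 0)] Q := by
    refine ae_eq_of_ae_le_of_lintegral_le
      (Eventually.of_forall fun t => (hgle t).trans (hPQ t)) ?_ hQm.aemeasurable ?_
    · rw [← hgi, heq]; exact hTV
    · rw [← hgi, heq]; exact hQi
  refine ⟨g, hgm, ?_⟩
  filter_upwards [hgQ] with t ht
  exact le_antisymm ((hPQ t).trans_eq ht.symm) (hgle t)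

/-! ### Product densities -/

theorem measurable_pi_prod {f : Fin N → ℝ → ℝ≥0∞} (hf : ∀ i, Measurable (f i)) :
    Measurable fun t : Fin N → ℝ => ∏ i, f i (t i) :=
  Finset.measurable_prod _ fun i _ => (hf i).comp (measurable_pi_apply i)

theorem lintegral_pi_prod (f : Fin N → ℝ → ℝ≥0∞) (hf : ∀ i, Measurable (f i)) :
    ∫⁻ t : Fin N → ℝ, ∏ i, f i (t i) = ∏ i, ∫⁻ s, f i s := by
  induction N with
  | zero => simp [volume_pi]
  | succ N ih =>
    have hmp := (volume_preserving_piFinSuccAbove (fun _ : Fin (N + 1) => ℝ) 0).symm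
    rw [← hmp.lintegral_comp (measurable_pi_prod hf), Fin.prod_univ_succ, ← ih _ fun i => hf i.succ]
    simp only [Fin.prod_univ_succ]
    rw [← lintegral_prod_mul (hf 0).aemeasurable (measurable_pi_prod fun i => hf i.succ).aemeasurable]
    rfl

theorem pi_withDensity (f : Fin N → ℝ → ℝ≥0∞) (hf : ∀ i, Measurable (f i))
    (h1 : ∀ i, ∫⁻ s, f i s = 1) :
    Measure.pi (fun i => (volume : Measure ℝ).withDensity (f i)) =
      (volume : Measure (Fin N → ℝ)).withDensity fun t => ∏ i, f i (t i) := by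
  have hp : ∀ i, IsProbabilityMeasure ((volume : Measure ℝ).withDensity (f i)) := fun i =>
    ⟨by simp [h1]⟩
  refine Measure.pi_eq fun s hs => ?_
  rw [withDensity_apply _ (MeasurableSet.univ_pi hs),
    ← lintegral_indicator (MeasurableSet.univ_pi hs)]
  have : ∀ t : Fin N → ℝ, (univ.pi s).indicator (fun t => ∏ i, f i (t i)) t =
      ∏ i, (s i).indicator (f i) (t i) := fun t => by
    by_cases h : t ∈ univ.pi s
    · rw [indicator_of_mem h]
      exact Finset.prod_congr rfl fun i _ => (indicator_of_mem (h i (mem_univ i)) _).symm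
    · rw [indicator_of_notMem h]
      obtain ⟨i, hi⟩ : ∃ i, t i ∉ s i := by simpa [mem_univ_pi] using h
      exact (Finset.prod_eq_zero (Finset.mem_univ i) (indicator_of_notMem hi _)).symm
  simp only [this]
  rw [lintegral_pi_prod _ fun i => (hf i).indicator (hs i)]
  refine Finset.prod_congr rfl fun i _ => ?_
  rw [lintegral_indicator (hs i), withDensity_apply _ (hs i)]

/-! ### Competitors and their superlevel sets -/

variable {Ω : Set (EuclideanSpace ℝ (Fin n))}
  {u : EuclideanSpace ℝ (Fin n) → EuclideanSpace ℝ (Fin N)}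

theorem apply_nonneg_of_mem_axes {y : EuclideanSpace ℝ (Fin N)} (hy : y ∈ axes N) (i : Fin N) :
    0 ≤ y i := by
  obtain ⟨k, t, ht, rfl⟩ := mem_iUnion.1 hy
  by_cases h : i = k <;> simp [h, ht]

theorem eq_of_pos_of_mem_axes {y : EuclideanSpace ℝ (Fin N)} (hy : y ∈ axes N) {i j : Fin N}
    (hi : 0 < y i) (hj : 0 < y j) : i = j := by
  obtain ⟨k, t, ht, rfl⟩ := mem_iUnion.1 hy
  have : ∀ l, 0 < (t • EuclideanSpace.single k (1 : ℝ)) l → l = k := fun l hl => by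
    by_contra h
    simp [h] at hl
  rw [this i hi, this j hj]

theorem IsCompetitor.ae_nonneg (hu : IsCompetitor Ω u) (i : Fin N) :
    0 ≤ᵐ[volume] fun x => u x i := by
  filter_upwards [hu.mem_axes, (hu.isBV i).eq_zero] with x hx h0
  by_cases h : x ∈ Ω
  · exact apply_nonneg_of_mem_axes (hx h) i
  · exact (h0 h).ge

theorem IsCompetitor.superlevel_ae_eq (hu : IsCompetitor Ω u) {t : Fin N → ℝ} {i : Fin N}
    (ht : 0 < t i) : superlevel Ω u t i =ᵐ[volume] {x | t i < u x i} := by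
  filter_upwards [(hu.isBV i).eq_zero] with x h0
  refine propext ⟨fun h => h.2, fun h => ⟨?_, h⟩⟩
  by_contra hx
  have h' : t i < u x i := h
  rw [h0 hx] at h'
  exact lt_asymm ht h'

theorem IsCompetitor.isCluster_superlevel (hu : IsCompetitor Ω u) {t : Fin N → ℝ}
    (ht : ∀ i, 0 < t i ∧ 0 < volume (superlevel Ω u t i)) : IsCluster Ω (superlevel Ω u t) where
  measurable i := by
    refine NullMeasurableSet.congr ?_ (hu.superlevel_ae_eq (ht i).1).symm
    exact nullMeasurableSet_lt aemeasurable_const (hu.isBV i).integrable.aemeasurable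
  subset i := fun x hx => hx.1
  volume_pos i := (ht i).2
  disjoint i j hij := by
    refine measure_mono_null ?_ (ae_iff.1 hu.mem_axes)
    rintro x ⟨hi, hj⟩ h
    exact hij (eq_of_pos_of_mem_axes (h hi.1) ((ht i).1.trans hi.2) ((ht j).1.trans hj.2))

theorem IsCompetitor.lintegral_volume_superlevel (hu : IsCompetitor Ω u) (i : Fin N) :
    ∫⁻ s in Ioi 0, volume {x | s < u x i} = 1 := by
  rw [← lintegral_eq_lintegral_meas_lt volume (hu.ae_nonneg i)
    (hu.isBV i).integrable.aemeasurable, ← hu.norm_eq_one i, eLpNorm_one_eq_lintegral_enorm]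
  refine lintegral_congr_ae ?_
  filter_upwards [hu.ae_nonneg i] with x hx
  exact (Real.enorm_of_nonneg hx).symm

/-- The energy of a competitor is the average of the Cheeger quotients of its superlevel sets, for
the probability measure on the thresholds `t` with density `∏ᵢ |{uⁱ > tᵢ}|` on `(0, ∞)ᴺ`. -/
theorem IsCompetitor.exists_measure_lintegral_cheegerQuotient (hu : IsCompetitor Ω u) :
    ∃ ν : Measure (Fin N → ℝ), IsProbabilityMeasure ν ∧
      (∀ p : (Fin N → ℝ) → Prop, (∀ᵐ t ∂ν, p t) ↔
        ∀ᵐ t : Fin N → ℝ, (∀ i, 0 < t i ∧ 0 < volume (superlevel Ω u t i)) → p t) ∧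
      AEMeasurable (fun t => cheegerQuotient (superlevel Ω u t)) ν ∧
      ∫⁻ t, cheegerQuotient (superlevel Ω u t) ∂ν = energy u := by
  let m : Fin N → ℝ → ℝ≥0∞ := fun i s => volume {x | s < u x i}
  have hm : ∀ i, Measurable (m i) := fun i =>
    Antitone.measurable fun a b hab => measure_mono fun x hx => lt_of_le_of_lt hab hx
  let P : Fin N → ℝ → ℝ≥0∞ := fun i s => perimeter {x | s < u x i}
  let f : Fin N → ℝ → ℝ≥0∞ := fun i => (Ioi 0).indicator (m i)
  have hf : ∀ i, Measurable (f i) := fun i => (hm i).indicator measurableSet_Ioi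
  have hf1 : ∀ i, ∫⁻ s, f i s = 1 := fun i => by
    rw [lintegral_indicator measurableSet_Ioi]
    exact hu.lintegral_volume_superlevel i
  have hp : ∀ i, IsProbabilityMeasure ((volume : Measure ℝ).withDensity (f i)) := fun i =>
    ⟨by simp [hf1]⟩
  have hνi : ∀ i, (volume : Measure ℝ).withDensity (f i) =
      (volume.restrict (Ioi 0)).withDensity (m i) := fun i =>
    withDensity_indicator measurableSet_Ioi _
  have hcoarea := fun i =>
    coarea (hu.isBV i).integrable (hu.ae_nonneg i) (hu.isBV i).totalVariation_ne_top
  have hdiv : ∀ i, AEMeasurable (fun s => P i s / m i s) (volume.restrict (Ioi 0)) := fun i =>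
    (hcoarea i).1.div (hm i).aemeasurable
  have hg : ∀ i, AEMeasurable (fun s => P i s / m i s)
      ((volume : Measure ℝ).withDensity (f i)) := fun i => by
    rw [hνi]
    exact (hdiv i).mono_ac (withDensity_absolutelyContinuous _ _)
  have hgi : ∀ i, ∫⁻ s, P i s / m i s ∂((volume : Measure ℝ).withDensity (f i)) =
      totalVariation fun x => u x i := fun i => by
    rw [hνi, lintegral_withDensity_eq_lintegral_mul₀ (hm i).aemeasurable (hdiv i),
      ← (hcoarea i).2]
    refine setLIntegral_congr_fun measurableSet_Ioi fun s hs => ?_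
    by_cases h0 : m i s = 0
    · simp [h0, perimeter_eq_zero_of_volume_eq_zero h0]
    · exact ENNReal.mul_div_cancel h0 ((hu.isBV i).integrable.measure_gt_lt_top hs).ne
  let ν : Measure (Fin N → ℝ) := Measure.pi fun i => (volume : Measure ℝ).withDensity (f i)
  have hiff : ∀ p : (Fin N → ℝ) → Prop, (∀ᵐ t ∂ν, p t) ↔
      ∀ᵐ t : Fin N → ℝ, (∀ i, 0 < t i ∧ 0 < volume (superlevel Ω u t i)) → p t := fun p => by
    rw [show ν = _ from pi_withDensity f hf hf1,
      ae_withDensity_iff (measurable_pi_prod hf)]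
    refine eventually_congr (Eventually.of_forall fun t => imp_congr_left ?_)
    rw [Finset.prod_ne_zero_iff]
    simp only [Finset.mem_univ, true_imp_iff]
    refine forall_congr' fun i => ?_
    by_cases ht : 0 < t i
    · simp only [f, indicator_of_mem (show t i ∈ Ioi 0 from ht), ht, true_and, pos_iff_ne_zero,
        measure_congr (hu.superlevel_ae_eq ht), m]
    · simp [f, ht]
  have hmp : ∀ i, MeasurePreserving (Function.eval i) ν
      ((volume : Measure ℝ).withDensity (f i)) := fun i => measurePreserving_eval _ i
  have hQ : (fun t => ∑ i, P i (t i) / m i (t i)) =ᵐ[ν]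
      fun t => cheegerQuotient (superlevel Ω u t) := by
    refine (hiff _).2 (Eventually.of_forall fun t ht => ?_)
    refine Finset.sum_congr rfl fun i _ => ?_
    rw [perimeter_congr_ae (hu.superlevel_ae_eq (ht i).1),
      measure_congr (hu.superlevel_ae_eq (ht i).1)]
  have hgν : ∀ i, AEMeasurable (fun t : Fin N → ℝ => P i (t i) / m i (t i)) ν := fun i =>
    (hg i).comp_quasiMeasurePreserving (hmp i).quasiMeasurePreserving
  refine ⟨ν, inferInstance, hiff, (Finset.aemeasurable_fun_sum _ fun i _ => hgν i).congr hQ, ?_⟩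
  rw [← lintegral_congr_ae hQ, lintegral_finsetSum' _ fun i _ => hgν i]
  refine Finset.sum_congr rfl fun i _ => ?_
  rw [← hgi i, ← (hmp i).map_eq, lintegral_map' (by rw [(hmp i).map_eq]; exact hg i)
    (measurable_pi_apply i).aemeasurable]

/-! ### Clusters as competitors -/

theorem IsCompetitor.relaxedConstant_le (hu : IsCompetitor Ω u) :
    relaxedConstant N Ω ≤ energy u := iInf₂_le u hu

theorem IsCluster.cheegerConstant_le {E : Fin N → Set (EuclideanSpace ℝ (Fin n))}
    (hE : IsCluster Ω E) : cheegerConstant N Ω ≤ cheegerQuotient E := iInf₂_le E hE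

theorem totalVariation_normalizedIndicators_le {E : Fin N → Set (EuclideanSpace ℝ (Fin n))}
    (i : Fin N) (h0 : volume (E i) ≠ 0) (h1 : volume (E i) ≠ ∞) :
    totalVariation (fun x => normalizedIndicators E x i) ≤ perimeter (E i) / volume (E i) := by
  have : (fun x => normalizedIndicators E x i) =
      fun x => ((volume (E i)).toReal)⁻¹ * (E i).indicator (fun _ => (1 : ℝ)) x := by
    ext x
    by_cases h : x ∈ E i <;> simp [normalizedIndicators, h]
  rw [this]
  refine (totalVariation_const_mul_le (inv_nonneg.2 ENNReal.toReal_nonneg) _).trans_eq ?_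
  rw [ENNReal.ofReal_inv_of_pos (ENNReal.toReal_pos h0 h1), ENNReal.ofReal_toReal h1, mul_comm,
    ← div_eq_mul_inv]
  rfl

theorem energy_normalizedIndicators_le (hΩ : Bornology.IsBounded Ω)
    {E : Fin N → Set (EuclideanSpace ℝ (Fin n))} (hE : IsCluster Ω E) :
    energy (normalizedIndicators E) ≤ cheegerQuotient E :=
  Finset.sum_le_sum fun i _ => totalVariation_normalizedIndicators_le i (hE.volume_pos i).ne'
    ((measure_mono (hE.subset i)).trans_lt hΩ.measure_lt_top).ne

theorem isCompetitor_normalizedIndicators (hN : 1 ≤ N) (hΩ : Bornology.IsBounded Ω)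
    {E : Fin N → Set (EuclideanSpace ℝ (Fin n))} (hE : IsCluster Ω E)
    (hfin : cheegerQuotient E ≠ ∞) : IsCompetitor Ω (normalizedIndicators E) := by
  have hvol : ∀ i, volume (E i) ≠ ∞ := fun i =>
    ((measure_mono (hE.subset i)).trans_lt hΩ.measure_lt_top).ne
  have hq : ∀ i, perimeter (E i) / volume (E i) ≠ ∞ := fun i =>
    ((ENNReal.sum_ne_top).1 hfin) i (Finset.mem_univ i)
  have happ : ∀ i, (fun x => normalizedIndicators E x i) =
      (E i).indicator fun _ => ((volume (E i)).toReal)⁻¹ := fun i => rfl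
  refine ⟨fun i => ⟨?_, ?_, ?_⟩, ?_, fun i => ?_⟩
  · exact (integrableOn_const (hvol i)).integrable_indicator₀ (hE.measurable i)
  · exact ne_top_of_le_ne_top (hq i)
      (totalVariation_normalizedIndicators_le i (hE.volume_pos i).ne' (hvol i))
  · refine Eventually.of_forall fun x hx => ?_
    exact (congrFun (happ i) x).trans (indicator_of_notMem (fun h => hx (hE.subset i h)) _)
  · have hdisj : ∀ᵐ x, ∀ i j, i ≠ j → ¬(x ∈ E i ∧ x ∈ E j) := by
      refine ae_all_iff.2 fun i => ae_all_iff.2 fun j => ?_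
      by_cases hij : i = j
      · simp [hij]
      · filter_upwards [measure_eq_zero_iff_ae_notMem.1 (hE.disjoint i j hij)] with x hx _ using hx
    filter_upwards [hdisj] with x hx _
    by_cases h : ∃ i, x ∈ E i
    · obtain ⟨i, hi⟩ := h
      refine mem_iUnion.2 ⟨i, ((volume (E i)).toReal)⁻¹, inv_nonneg.2 ENNReal.toReal_nonneg, ?_⟩
      ext j
      by_cases hj : j = i
      · subst hj; simp [normalizedIndicators, hi]
      · have : x ∉ E j := fun h => hx j i hj ⟨h, hi⟩
        simp [normalizedIndicators, hj, this]
    · push Not at h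
      refine mem_iUnion.2 ⟨⟨0, hN⟩, 0, le_rfl, ?_⟩
      ext j
      simp [normalizedIndicators, h j]
  · rw [happ, eLpNorm_one_eq_lintegral_enorm]
    simp only [enorm_indicator_eq_indicator_enorm]
    rw [lintegral_indicator_const₀ (hE.measurable i), Real.enorm_of_nonneg
      (inv_nonneg.2 ENNReal.toReal_nonneg),
      ENNReal.ofReal_inv_of_pos (ENNReal.toReal_pos (hE.volume_pos i).ne' (hvol i)),
      ENNReal.ofReal_toReal (hvol i), ENNReal.inv_mul_cancel (hE.volume_pos i).ne' (hvol i)]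

theorem relaxedConstant_le_cheegerConstant (hN : 1 ≤ N) (hΩ : Bornology.IsBounded Ω) :
    relaxedConstant N Ω ≤ cheegerConstant N Ω := by
  refine le_iInf₂ fun E hE => ?_
  by_cases hfin : cheegerQuotient E = ∞
  · rw [hfin]; exact le_top
  · exact (isCompetitor_normalizedIndicators hN hΩ hE hfin).relaxedConstant_le.trans
      (energy_normalizedIndicators_le hΩ hE)

theorem cheegerConstant_le_relaxedConstant : cheegerConstant N Ω ≤ relaxedConstant N Ω := by
  refine le_iInf₂ fun u hu => ?_
  obtain ⟨ν, hν, hiff, -, hint⟩ := hu.exists_measure_lintegral_cheegerQuotient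
  calc cheegerConstant N Ω = ∫⁻ _, cheegerConstant N Ω ∂ν := by simp
    _ ≤ ∫⁻ t, cheegerQuotient (superlevel Ω u t) ∂ν := lintegral_mono_ae <| (hiff _).2 <|
        Eventually.of_forall fun t ht => (hu.isCluster_superlevel ht).cheegerConstant_le
    _ = energy u := hint

/-! ### Finiteness -/

/-- Normalized bump functions supported in disjoint balls contained in `Ω` have finite energy. -/
theorem relaxedConstant_ne_top (hn : 1 ≤ n) (hN : 1 ≤ N) (hne : Ω.Nonempty) (ho : IsOpen Ω) :
    relaxedConstant N Ω ≠ ∞ := by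
  obtain ⟨x₀, hx₀⟩ := hne
  obtain ⟨r, hr, hball⟩ := Metric.isOpen_iff.1 ho x₀ hx₀
  let e : EuclideanSpace ℝ (Fin n) := EuclideanSpace.single ⟨0, hn⟩ 1
  have he : ‖e‖ = 1 := by simp [e]
  let δ : ℝ := r / (N + 1)
  have hδ : 0 < δ := by positivity
  have hδr : δ * (N + 1) = r := by simp only [δ]; field_simp
  let c : Fin N → EuclideanSpace ℝ (Fin n) := fun i => x₀ + ((i : ℝ) * δ) • e
  let b : ∀ i, ContDiffBump (c i) := fun i => ⟨δ / 4, δ / 2, by positivity, by linarith⟩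
  let w : Fin N → EuclideanSpace ℝ (Fin n) → ℝ := fun i => (b i).normed volume
  have hsupp : ∀ i x, w i x ≠ 0 → dist x (c i) < δ / 2 := fun i x hx => by
    have : x ∈ Function.support ((b i).normed volume) := hx
    rwa [(b i).support_normed_eq] at this
  have hsub : ∀ i x, w i x ≠ 0 → x ∈ Ω := fun i x hx => hball <| by
    have h1 := hsupp i x hx
    have h2 : dist (c i) x₀ = i * δ := by
      simp only [c, dist_eq_norm, add_sub_cancel_left, norm_smul, he, mul_one]
      exact Real.norm_of_nonneg (by positivity)
    have h3 : ((i : ℕ) : ℝ) + 1 ≤ N := by exact_mod_cast i.2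
    have h4 := dist_triangle x (c i) x₀
    rw [Metric.mem_ball]
    nlinarith
  have hdisj : ∀ x i j, w i x ≠ 0 → w j x ≠ 0 → i = j := fun x i j hi hj => by
    by_contra hij
    have h1 := hsupp i x hi
    have h2 := hsupp j x hj
    have h3 : dist (c i) (c j) = |((i : ℕ) : ℝ) - (j : ℕ)| * δ := by
      simp only [c, dist_eq_norm, add_sub_add_left_eq_sub, ← sub_smul, norm_smul, he, mul_one,
        ← sub_mul, Real.norm_eq_abs, abs_mul, abs_of_pos hδ]
    have h4 : (1 : ℝ) ≤ |((i : ℕ) : ℝ) - (j : ℕ)| := by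
      have : (1 : ℤ) ≤ |((i : ℕ) : ℤ) - (j : ℕ)| :=
        Int.one_le_abs (by have := Fin.val_ne_of_ne hij; omega)
      exact_mod_cast this
    have h5 := dist_triangle_left (c i) (c j) x
    nlinarith
  have hcd : ∀ i, ContDiff ℝ ((⊤ : ℕ∞) : WithTop ℕ∞) (w i) := fun i => (b i).contDiff_normed
  have hcs : ∀ i, HasCompactSupport (w i) := fun i => (b i).hasCompactSupport_normed
  have hgs : ∀ i, HasCompactSupport (grad (w i)) := fun i =>
    ((hcs i).fderiv ℝ).comp_left (g := fun L : EuclideanSpace ℝ (Fin n) →L[ℝ] ℝ =>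
      (WithLp.toLp 2 fun j => L (EuclideanSpace.single j 1) : EuclideanSpace ℝ (Fin n)))
      (by ext; simp)
  have hTV : ∀ i, totalVariation (w i) ≠ ∞ := fun i =>
    ((totalVariation_le_lintegral_grad (hcd i)).trans_lt
      ((contDiff_grad (hcd i)).continuous.integrable_of_hasCompactSupport (hgs i)).2).ne
  let u : EuclideanSpace ℝ (Fin n) → EuclideanSpace ℝ (Fin N) := fun x =>
    WithLp.toLp 2 fun i => w i x
  have hu : IsCompetitor Ω u := by
    refine ⟨fun i => ⟨(b i).integrable_normed, hTV i, ?_⟩, ?_, fun i => ?_⟩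
    · refine Eventually.of_forall fun x hx => ?_
      by_contra h
      exact hx (hsub i x h)
    · refine Eventually.of_forall fun x _ => ?_
      by_cases h : ∃ i, w i x ≠ 0
      · obtain ⟨i, hi⟩ := h
        refine mem_iUnion.2 ⟨i, w i x, (b i).nonneg_normed x, ?_⟩
        ext j
        by_cases hj : j = i
        · subst hj; simp [u]
        · have : w j x = 0 := by
            by_contra h
            exact hj (hdisj x j i h hi)
          simp [u, hj, this]
      · push Not at h
        refine mem_iUnion.2 ⟨⟨0, hN⟩, 0, le_rfl, ?_⟩
        ext j
        simp [u, h j]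
    · rw [eLpNorm_one_eq_lintegral_enorm]
      change ∫⁻ x, ‖w i x‖ₑ = 1
      simp only [Real.enorm_of_nonneg ((b i).nonneg_normed _), w]
      rw [← ofReal_integral_eq_lintegral_ofReal (b i).integrable_normed
        (Eventually.of_forall fun x => (b i).nonneg_normed x), (b i).integral_normed,
        ENNReal.ofReal_one]
  exact ne_top_of_le_ne_top (ENNReal.sum_ne_top.2 fun i _ => hTV i) hu.relaxedConstant_le

/-! ### Minimizers and Cheeger clusters -/

/-- A nonnegative function whose average equals its lower bound is almost everywhere constant;
here the function is the Cheeger quotient of the superlevel sets. -/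
theorem IsCompetitor.isRelaxedMinimizer_iff (hu : IsCompetitor Ω u)
    (hΛH : relaxedConstant N Ω = cheegerConstant N Ω) (hfin : relaxedConstant N Ω ≠ ∞) :
    IsRelaxedMinimizer Ω u ↔ ∀ᵐ t : Fin N → ℝ,
      (∀ i, 0 < t i ∧ 0 < volume (superlevel Ω u t i)) →
        IsCheegerCluster Ω (superlevel Ω u t) := by
  obtain ⟨ν, hν, hiff, hmeas, hint⟩ := hu.exists_measure_lintegral_cheegerQuotient
  have hcl : ∀ᵐ t ∂ν, IsCluster Ω (superlevel Ω u t) :=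
    (hiff _).2 (Eventually.of_forall fun t ht => hu.isCluster_superlevel ht)
  have hconst : ∫⁻ _ : Fin N → ℝ, cheegerConstant N Ω ∂ν = cheegerConstant N Ω := by simp
  rw [← hiff]
  constructor
  · rintro ⟨-, hmin⟩
    have hae : (fun _ => cheegerConstant N Ω) =ᵐ[ν]
        fun t => cheegerQuotient (superlevel Ω u t) := by
      refine ae_eq_of_ae_le_of_lintegral_le ?_ ?_ hmeas ?_
      · filter_upwards [hcl] with t ht using ht.cheegerConstant_le
      · rw [hconst, ← hΛH]; exact hfin
      · rw [hint, hconst, hmin, hΛH]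
    filter_upwards [hcl, hae] with t h1 h2 using ⟨h1, h2.symm⟩
  · intro h
    refine ⟨hu, ?_⟩
    rw [← hint, hΛH, ← hconst]
    exact lintegral_congr_ae (by filter_upwards [h] with t ht using ht.2)

theorem IsCheegerCluster.isRelaxedMinimizer (hN : 1 ≤ N) (hΩ : Bornology.IsBounded Ω)
    (hΛH : relaxedConstant N Ω = cheegerConstant N Ω) (hfin : relaxedConstant N Ω ≠ ∞)
    {E : Fin N → Set (EuclideanSpace ℝ (Fin n))} (hE : IsCheegerCluster Ω E) :
    IsRelaxedMinimizer Ω (normalizedIndicators E) := by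
  have hcomp := isCompetitor_normalizedIndicators hN hΩ hE.1 (by rw [hE.2, ← hΛH]; exact hfin)
  refine ⟨hcomp, le_antisymm ?_ hcomp.relaxedConstant_le⟩
  rw [hΛH, ← hE.2]
  exact energy_normalizedIndicators_le hΩ hE.1

end CheegerCluster

theorem theorem3p2 (n N : ℕ) (hn : 1 ≤ n) (hN : 1 ≤ N)
    (Ω : Set (EuclideanSpace ℝ (Fin n))) (hΩ_nonempty : Ω.Nonempty) (hΩ_open : IsOpen Ω)
    (hΩ_bounded : Bornology.IsBounded Ω) :
    CheegerCluster.relaxedConstant N Ω ≠ ∞ ∧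
    CheegerCluster.relaxedConstant N Ω = CheegerCluster.cheegerConstant N Ω ∧
    (∀ u : EuclideanSpace ℝ (Fin n) → EuclideanSpace ℝ (Fin N),
      CheegerCluster.IsCompetitor Ω u →
      (CheegerCluster.IsRelaxedMinimizer Ω u ↔
        ∀ᵐ t : Fin N → ℝ,
          (∀ i, 0 < t i ∧ 0 < volume (CheegerCluster.superlevel Ω u t i)) →
            CheegerCluster.IsCheegerCluster Ω (CheegerCluster.superlevel Ω u t))) ∧
    (∀ E : Fin N → Set (EuclideanSpace ℝ (Fin n)),
      CheegerCluster.IsCheegerCluster Ω E →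
      CheegerCluster.IsRelaxedMinimizer Ω (CheegerCluster.normalizedIndicators E)) := by
  have hfin := CheegerCluster.relaxedConstant_ne_top hn hN hΩ_nonempty hΩ_open
  have heq : CheegerCluster.relaxedConstant N Ω = CheegerCluster.cheegerConstant N Ω :=
    le_antisymm (CheegerCluster.relaxedConstant_le_cheegerConstant hN hΩ_bounded)
      CheegerCluster.cheegerConstant_le_relaxedConstant
  exact ⟨hfin, heq, fun u hu => hu.isRelaxedMinimizer_iff heq hfin,
    fun E hE => hE.isRelaxedMinimizer hN hΩ_bounded heq hfin⟩
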